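/- Let $(p_n)_{n\ge 1}$ be positive integers with $p_n\to\infty$ as $n\to\infty$ (for instance $p_n=n$). For every $n$, writing $p=p_n$, let $a_{p,1}\ge a_{p,2}\ge\dots\ge a_{p,p}\ge 0$ and $b_{p,1}\ge b_{p,2}\ge\dots\ge b_{p,p}\ge 0$ be real numbers (which may depend on $n$) with $\sum_{j=1}^p a_{p,j}^2=\sum_{j=1}^p b_{p,j}^2=1$, and assume that $\max_{1\le j\le p}|a_{p,j}-b_{p,j}|\to 0$ as $n\to\infty$. Let $\eta_1,\eta_2,\dots$ be independent random variables on a probability space, each with the $\chi^2_1$ distribution (the law of the square of a standard normal variable), and set $$V_a=\sum_{j=1}^p a_{p,j}(\eta_j-1),\qquad V_b=\sum_{j=1}^p b_{p,j}(\eta_j-1).$$ Then $$\sup_{x\in\mathbb R}\bigl|\mathbb P(V_a\le x)-\mathbb P(V_b\le x)\bigr|\to 0\qquad\text{as } n\to\infty .$$ -/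

import Mathlib

open MeasureTheory ProbabilityTheory Filter Topology

/-- The chi-squared distribution with one degree of freedom: the law of the square of a
standard normal random variable. -/
noncomputable def chiSqOne : Measure ℝ :=
  (gaussianReal 0 1).map (fun z : ℝ => z ^ 2)

/-- The centered weighted sum `∑ j, w j * (η j - 1)` with `p` weights. The weights are indexed
by `0, …, p - 1` instead of `1, …, p`. -/
def centeredMixture {Ω : Type*} (η : ℕ → Ω → ℝ) {p : ℕ} (w : Fin p → ℝ) (ω : Ω) : ℝ :=
  ∑ j : Fin p, w j * (η j ω - 1)

/-- The Kolmogorov distance `sup_x |P(X ≤ x) - P(Y ≤ x)|` between two random variables.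
The supremum is over numbers in `[0, 1]` when `P` is a probability measure. -/
noncomputable def kolmogorovDist {Ω : Type*} [MeasurableSpace Ω] (P : Measure Ω)
    (X Y : Ω → ℝ) : ℝ :=
  ⨆ x : ℝ, |P.real {ω | X ω ≤ x} - P.real {ω | Y ω ≤ x}|

section ChiSquareCharFun

open Complex

lemma one_sub_two_mul_I_mem_slitPlane (s : ℝ) : 1 - 2 * s * I ∈ slitPlane := by
  left; simp

/-- The characteristic function of the chi-squared distribution with one degree of freedom. -/
lemma charFun_chiSqOne (s : ℝ) :
    charFun chiSqOne s = exp (-(1 / 2) * log (1 - 2 * s * I)) := by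
  have hne : (1 - 2 * s * I : ℂ) ≠ 0 := slitPlane_ne_zero (one_sub_two_mul_I_mem_slitPlane s)
  have hre : 0 < re (1 / 2 - s * I : ℂ) := by simp
  rw [charFun_apply_real, chiSqOne, integral_map (by fun_prop) (by fun_prop),
    integral_gaussianReal_eq_integral_smul one_ne_zero]
  have hint : ∀ x : ℝ, gaussianPDFReal 0 1 x • exp (s * ((x ^ 2 : ℝ) : ℂ) * I)
      = ((√(2 * Real.pi))⁻¹ : ℝ) * exp (-(1 / 2 - s * I) * (x : ℂ) ^ 2) := by
    intro x
    rw [gaussianPDFReal_def, real_smul, ofReal_mul, mul_assoc, ofReal_exp, ← exp_add]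
    simp only [NNReal.coe_one, mul_one, sub_zero]
    congr 2
    push_cast
    ring
  simp_rw [hint]
  rw [integral_const_mul, integral_gaussian_complex hre]
  have hq : (Real.pi / (1 / 2 - s * I) : ℂ) = ((2 * Real.pi : ℝ) : ℂ) * (1 - 2 * s * I)⁻¹ := by
    have : (1 / 2 - s * I : ℂ) ≠ 0 := fun h => by
      rw [h] at hre; simp at hre
    field_simp
    push_cast
    ring
  have harg : arg (1 - 2 * s * I) ≠ Real.pi :=
    slitPlane_arg_ne_pi (one_sub_two_mul_I_mem_slitPlane s)
  have hpi : (0 : ℝ) < 2 * Real.pi := by positivity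
  have hroot : (((√(2 * Real.pi))⁻¹ : ℝ) : ℂ)
      = exp (((-(1 / 2) * Real.log (2 * Real.pi) : ℝ)) : ℂ) := by
    rw [← ofReal_exp, Real.sqrt_eq_rpow, ← Real.rpow_neg hpi.le, Real.rpow_def_of_pos hpi,
      mul_comm]
  rw [hq, cpow_def_of_ne_zero (mul_ne_zero (by exact_mod_cast hpi.ne') (inv_ne_zero hne)),
    log_ofReal_mul hpi (inv_ne_zero hne), log_inv _ harg, hroot, ← exp_add]
  congr 1
  push_cast
  ring

lemma norm_charFun_chiSqOne_pow_four (s : ℝ) :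
    ‖charFun chiSqOne s‖ ^ 4 = (1 + 4 * s ^ 2)⁻¹ := by
  have hne : (1 - 2 * s * I : ℂ) ≠ 0 := slitPlane_ne_zero (one_sub_two_mul_I_mem_slitPlane s)
  have h2 : charFun chiSqOne s ^ 2 = (1 - 2 * s * I)⁻¹ := by
    rw [charFun_chiSqOne, ← exp_nat_mul, ← exp_log (inv_ne_zero hne),
      log_inv _ (slitPlane_arg_ne_pi (one_sub_two_mul_I_mem_slitPlane s))]
    congr 1
    push_cast
    ring
  rw [show 4 = 2 * 2 from rfl, pow_mul, ← norm_pow, h2, norm_inv, inv_pow, ← normSq_eq_norm_sq,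
    normSq_apply]
  simp
  ring

/-- The logarithm of the characteristic function of the centered chi-squared distribution, with
its quadratic term removed. -/
noncomputable def chiSqLogRemainder (s : ℝ) : ℂ :=
  s ^ 2 - s * I - 1 / 2 * log (1 - 2 * s * I)

lemma chiSqLogRemainder_zero : chiSqLogRemainder 0 = 0 := by
  simp [chiSqLogRemainder]

lemma hasDerivAt_chiSqLogRemainder (s : ℝ) :
    HasDerivAt chiSqLogRemainder (-(4 * s ^ 2 * I) / (1 - 2 * s * I)) s := by
  have hne : (1 - 2 * s * I : ℂ) ≠ 0 := slitPlane_ne_zero (one_sub_two_mul_I_mem_slitPlane s)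
  have hid : HasDerivAt (fun s : ℝ => (s : ℂ)) 1 s := ofRealCLM.hasDerivAt
  have hlog : HasDerivAt (fun s : ℝ => log (1 - 2 * s * I)) (-(2 * 1 * I) / (1 - 2 * s * I)) s :=
    HasDerivAt.clog_real (((hid.const_mul 2).mul_const I).const_sub 1)
      (one_sub_two_mul_I_mem_slitPlane s)
  convert! ((hid.pow 2).sub (hid.mul_const I)).sub (hlog.const_mul (1 / 2)) using 1
  have hinv := mul_inv_cancel₀ hne
  simp only [div_eq_mul_inv]
  generalize (1 - 2 * s * I : ℂ)⁻¹ = E at hinv ⊢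
  norm_num
  linear_combination (2 * (s : ℂ) - I) * hinv - 2 * s * E * I_sq

lemma norm_chiSqLogRemainder_sub_le {x y M : ℝ} (hx : |x| ≤ M) (hy : |y| ≤ M) :
    ‖chiSqLogRemainder x - chiSqLogRemainder y‖ ≤ 4 * M ^ 2 * |x - y| := by
  refine Convex.norm_image_sub_le_of_norm_hasDerivWithin_le (s := Set.Icc (-M) M)
    (fun s _ => (hasDerivAt_chiSqLogRemainder s).hasDerivWithinAt) (fun s hs => ?_)
    (convex_Icc _ _) (abs_le.mp hy) (abs_le.mp hx)
  have h1 : 1 ≤ ‖(1 - 2 * s * I : ℂ)‖ := by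
    simpa using abs_re_le_norm (1 - 2 * s * I : ℂ)
  have hsM : s ^ 2 ≤ M ^ 2 := sq_le_sq' hs.1 hs.2
  have hnum : ‖(-(4 * s ^ 2 * I) : ℂ)‖ = 4 * s ^ 2 := by simp
  rw [norm_div, hnum]
  exact (div_le_self (by positivity) h1).trans (by linarith)

lemma norm_chiSqLogRemainder_le (x : ℝ) : ‖chiSqLogRemainder x‖ ≤ 4 * |x| ^ 3 := by
  have h := norm_chiSqLogRemainder_sub_le (x := x) (y := 0) (M := |x|) le_rfl (by simp)
  rw [chiSqLogRemainder_zero, sub_zero, sub_zero] at h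
  linarith [show 4 * |x| ^ 2 * |x| = 4 * |x| ^ 3 by ring]

end ChiSquareCharFun

section CenteredMixture

variable {Ω : Type*} [MeasurableSpace Ω] {P : Measure Ω}
  {η : ℕ → Ω → ℝ} {p : ℕ}

lemma aemeasurable_centeredMixture (hη : ∀ j, HasLaw (η j) chiSqOne P) (w : Fin p → ℝ) :
    AEMeasurable (centeredMixture η w) P := by
  have := fun j => (hη j).aemeasurable
  unfold centeredMixture
  fun_prop

lemma charFun_centeredMixture (hind : iIndepFun η P) (hη : ∀ j, HasLaw (η j) chiSqOne P)
    (w : Fin p → ℝ) (t : ℝ) :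
    charFun (P.map (centeredMixture η w)) t
      = ∏ j, Complex.exp (-(t * w j : ℝ) * Complex.I) * charFun chiSqOne (t * w j) := by
  have hm := fun j => (hη j).aemeasurable
  have hi : iIndepFun (fun (j : Fin p) ω => w j * (η j ω - 1)) P :=
    (hind.precomp Fin.val_injective).comp (fun j x => w j * (x - 1)) (fun j => by fun_prop)
  have hX := hi.charFun_map_fun_sum_eq_prod (fun j => by fun_prop)
  change charFun (P.map fun ω => ∑ j : Fin p, w j * (η j ω - 1)) t = _
  rw [hX, Finset.prod_apply]
  refine Finset.prod_congr rfl fun j _ => ?_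
  rw [charFun_apply_real, integral_map (by fun_prop) (by fun_prop), ← (hη j).map_eq,
    charFun_apply_real, integral_map (hm j) (by fun_prop), ← integral_const_mul]
  congr 1 with ω
  rw [← Complex.exp_add]
  congr 1
  push_cast
  ring

lemma charFun_centeredMixture_eq_exp (hind : iIndepFun η P)
    (hη : ∀ j, HasLaw (η j) chiSqOne P) {w : Fin p → ℝ} (hw : ∑ j, w j ^ 2 = 1) (t : ℝ) :
    charFun (P.map (centeredMixture η w)) t
      = Complex.exp (∑ j, chiSqLogRemainder (t * w j) - t ^ 2) := by
  have hsq : (t ^ 2 : ℂ) = ∑ j, ((t * w j : ℝ) : ℂ) ^ 2 := by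
    have : t ^ 2 = ∑ j, (t * w j) ^ 2 := by
      simp_rw [mul_pow]; rw [← Finset.mul_sum, hw, mul_one]
    exact_mod_cast this
  rw [charFun_centeredMixture hind hη, hsq, ← Finset.sum_sub_distrib, Complex.exp_sum]
  refine Finset.prod_congr rfl fun j _ => ?_
  rw [charFun_chiSqOne, ← Complex.exp_add, chiSqLogRemainder]
  congr 1
  ring

lemma Finset.one_add_sum_le_prod_one_add_of_nonneg {ι : Type*} (s : Finset ι) {f : ι → ℝ}
    (hf : ∀ i ∈ s, 0 ≤ f i) : 1 + ∑ i ∈ s, f i ≤ ∏ i ∈ s, (1 + f i) := by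
  classical
  induction s using Finset.induction_on with
  | empty => simp
  | insert a s ha ih =>
    rw [Finset.sum_insert ha, Finset.prod_insert ha]
    have h1 := ih fun i hi => hf i (Finset.mem_insert_of_mem hi)
    have h2 := hf a (Finset.mem_insert_self a s)
    have h3 : 0 ≤ ∑ i ∈ s, f i :=
      Finset.sum_nonneg fun i hi => hf i (Finset.mem_insert_of_mem hi)
    nlinarith [mul_nonneg h2 h3]

lemma norm_charFun_centeredMixture_le (hind : iIndepFun η P)
    (hη : ∀ j, HasLaw (η j) chiSqOne P) {w : Fin p → ℝ} (hw : ∑ j, w j ^ 2 = 1) (t : ℝ) :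
    ‖charFun (P.map (centeredMixture η w)) t‖ ≤ √√(1 + 4 * t ^ 2)⁻¹ := by
  refine Real.le_sqrt_of_sq_le (Real.le_sqrt_of_sq_le ?_)
  rw [← pow_mul, charFun_centeredMixture hind hη, norm_prod, ← Finset.prod_pow]
  have hexp : ∀ x : ℝ, ‖Complex.exp (-(x : ℂ) * Complex.I)‖ = 1 := fun x => by
    rw [← Complex.ofReal_neg]; exact Complex.norm_exp_ofReal_mul_I _
  simp_rw [norm_mul, hexp, one_mul]
  simp_rw [show 2 * 2 = 4 from rfl, norm_charFun_chiSqOne_pow_four, Finset.prod_inv_distrib]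
  refine inv_anti₀ (by positivity) ?_
  refine le_trans (le_of_eq ?_)
    (Finset.one_add_sum_le_prod_one_add_of_nonneg (f := fun j => 4 * (t * w j) ^ 2) _
      fun j _ => by positivity)
  simp_rw [mul_pow]
  rw [← Finset.mul_sum, ← Finset.mul_sum, hw, mul_one]

lemma norm_one_sub_charFun_centeredMixture_le (hind : iIndepFun η P)
    (hη : ∀ j, HasLaw (η j) chiSqOne P) {w : Fin p → ℝ} (hw : ∑ j, w j ^ 2 = 1) {t : ℝ}
    (ht : 5 * t ^ 2 ≤ 1) :
    ‖1 - charFun (P.map (centeredMixture η w)) t‖ ≤ 10 * t ^ 2 := by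
  have ht1 : |t| ≤ 1 := by rw [← sq_le_one_iff_abs_le_one]; linarith [sq_nonneg t]
  have hterm : ∀ j, ‖chiSqLogRemainder (t * w j)‖ ≤ 4 * t ^ 2 * w j ^ 2 := fun j => by
    have hwj : |w j| ≤ 1 := by
      rw [← sq_le_one_iff_abs_le_one, ← hw]
      exact Finset.single_le_sum (f := fun j => w j ^ 2) (fun i _ => sq_nonneg _)
        (Finset.mem_univ j)
    have htw : |t * w j| ≤ 1 := by
      rw [abs_mul]; exact mul_le_one₀ ht1 (abs_nonneg _) hwj
    calc ‖chiSqLogRemainder (t * w j)‖ ≤ 4 * (|t * w j| ^ 2 * |t * w j|) := by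
          rw [← pow_succ]; exact norm_chiSqLogRemainder_le _
      _ ≤ 4 * (|t * w j| ^ 2 * 1) := by gcongr
      _ = 4 * t ^ 2 * w j ^ 2 := by rw [sq_abs]; ring
  have hsum : ‖∑ j, chiSqLogRemainder (t * w j)‖ ≤ 4 * t ^ 2 :=
    calc _ ≤ ∑ j, 4 * t ^ 2 * w j ^ 2 := norm_sum_le_of_le _ fun j _ => hterm j
      _ = 4 * t ^ 2 := by rw [← Finset.mul_sum, hw, mul_one]
  have hu : ‖∑ j, chiSqLogRemainder (t * w j) - (t : ℂ) ^ 2‖ ≤ 5 * t ^ 2 := by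
    refine (norm_sub_le _ _).trans ?_
    have : ‖(t : ℂ) ^ 2‖ = t ^ 2 := by simp
    linarith
  rw [charFun_centeredMixture_eq_exp hind hη hw, norm_sub_rev]
  linarith [Complex.norm_exp_sub_one_le (hu.trans ht)]

lemma norm_charFun_centeredMixture_sub_le [IsProbabilityMeasure P] (hind : iIndepFun η P)
    (hη : ∀ j, HasLaw (η j) chiSqOne P) {w v : Fin p → ℝ} (hw : ∑ j, w j ^ 2 = 1)
    (hv : ∑ j, v j ^ 2 = 1) {δ : ℝ} (hwv : ∀ j, |w j - v j| ≤ δ) {t : ℝ}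
    (ht : 8 * |t| ^ 3 * δ ≤ 1) :
    ‖charFun (P.map (centeredMixture η w)) t - charFun (P.map (centeredMixture η v)) t‖
      ≤ 16 * |t| ^ 3 * δ := by
  have hterm : ∀ j, ‖chiSqLogRemainder (t * w j) - chiSqLogRemainder (t * v j)‖
      ≤ 4 * |t| ^ 3 * δ * (w j ^ 2 + v j ^ 2) := fun j => by
    have hM : |t * w j - t * v j| ≤ |t| * δ := by
      rw [← mul_sub, abs_mul]; exact mul_le_mul_of_nonneg_left (hwv j) (abs_nonneg t)
    have h1 : |t * w j| ≤ |t| * √(w j ^ 2 + v j ^ 2) := by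
      rw [abs_mul]
      exact mul_le_mul_of_nonneg_left (Real.abs_le_sqrt (by linarith [sq_nonneg (v j)]))
        (abs_nonneg t)
    have h2 : |t * v j| ≤ |t| * √(w j ^ 2 + v j ^ 2) := by
      rw [abs_mul]
      exact mul_le_mul_of_nonneg_left (Real.abs_le_sqrt (by linarith [sq_nonneg (w j)]))
        (abs_nonneg t)
    calc _ ≤ 4 * (|t| * √(w j ^ 2 + v j ^ 2)) ^ 2 * |t * w j - t * v j| :=
          norm_chiSqLogRemainder_sub_le h1 h2
      _ ≤ 4 * (|t| * √(w j ^ 2 + v j ^ 2)) ^ 2 * (|t| * δ) := by gcongr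
      _ = 4 * |t| ^ 3 * δ * (w j ^ 2 + v j ^ 2) := by
          rw [mul_pow, Real.sq_sqrt (by positivity)]; ring
  set A : ℂ := ∑ j, chiSqLogRemainder (t * w j) - (t : ℂ) ^ 2 with hA
  set B : ℂ := ∑ j, chiSqLogRemainder (t * v j) - (t : ℂ) ^ 2 with hB
  have hAB : ‖A - B‖ ≤ 8 * |t| ^ 3 * δ := by
    rw [hA, hB, sub_sub_sub_cancel_right, ← Finset.sum_sub_distrib]
    calc _ ≤ ∑ j, 4 * |t| ^ 3 * δ * (w j ^ 2 + v j ^ 2) :=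
          norm_sum_le_of_le _ fun j _ => hterm j
      _ = 8 * |t| ^ 3 * δ := by
          rw [← Finset.mul_sum, Finset.sum_add_distrib, hw, hv]; ring
  have hfB := charFun_centeredMixture_eq_exp hind hη hv t
  have := Measure.isProbabilityMeasure_map (aemeasurable_centeredMixture hη v)
  have hBle : ‖Complex.exp B‖ ≤ 1 := hfB ▸ norm_charFun_le_one t
  rw [charFun_centeredMixture_eq_exp hind hη hw t, hfB,
    show Complex.exp A - Complex.exp B = Complex.exp B * (Complex.exp (A - B) - 1) by
      rw [mul_sub, ← Complex.exp_add]; simp, norm_mul]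
  calc _ ≤ 1 * (2 * ‖A - B‖) := by
        gcongr; exact Complex.norm_exp_sub_one_le (hAB.trans ht)
    _ ≤ 16 * |t| ^ 3 * δ := by linarith

end CenteredMixture

section WeakConvergence

/-- Two sequences of probability measures on `ℝ`, one of them tight, whose characteristic functions
are asymptotically equal, are asymptotically equal in the Lévy-Prokhorov distance. -/
lemma tendsto_levyProkhorovEDist_of_tendsto_charFun_sub {μ ν : ℕ → ProbabilityMeasure ℝ}
    (htight : IsTightMeasureSet (Set.range fun n => (μ n : Measure ℝ)))
    (h : ∀ t : ℝ, Tendsto (fun n => charFun (μ n : Measure ℝ) t - charFun (ν n : Measure ℝ) t)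
      atTop (𝓝 0)) :
    Tendsto (fun n => levyProkhorovEDist (μ n : Measure ℝ) (ν n : Measure ℝ)) atTop (𝓝 0) := by
  have hcomp : IsCompact (closure (Set.range μ)) := by
    refine isCompact_closure_of_isTightMeasureSet ?_
    convert! htight using 1
    ext; simp
  refine tendsto_of_subseq_tendsto fun ns hns => ?_
  obtain ⟨κ, -, φ, hφ, hμ⟩ := hcomp.isSeqCompact (x := fun n => μ (ns n))
    (fun n => subset_closure ⟨_, rfl⟩)
  refine ⟨φ, ?_⟩
  have hν : Tendsto (fun n => ν (ns (φ n))) atTop (𝓝 κ) := by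
    refine ProbabilityMeasure.tendsto_of_tendsto_charFun fun t => ?_
    have h1 := ProbabilityMeasure.tendsto_iff_tendsto_charFun.mp hμ t
    have h2 := (h t).comp (hns.comp hφ.tendsto_atTop)
    simpa [Function.comp_def] using h1.sub h2
  have hc := (LevyProkhorov.probabilityMeasureHomeomorph (Ω := ℝ)).continuous.tendsto κ
  have h3 := (hc.comp hμ).edist (hc.comp hν)
  rw [edist_self] at h3
  exact h3

lemma isTightMeasureSet_range_of_norm_one_sub_charFun_le {μ : ℕ → Measure ℝ}
    [∀ n, IsProbabilityMeasure (μ n)] {C δ : ℝ} (hδ : 0 < δ)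
    (h : ∀ n t, |t| ≤ δ → ‖1 - charFun (μ n) t‖ ≤ C * t ^ 2) :
    IsTightMeasureSet (Set.range μ) := by
  have hC : 0 ≤ C := by
    have := (norm_nonneg _).trans (h 0 δ (abs_of_pos hδ).le)
    exact nonneg_of_mul_nonneg_left this (by positivity)
  have hbound : ∀ r : ℝ, 2 * δ⁻¹ ≤ r →
      ⨆ ν ∈ Set.range μ, ν {x | r < ‖x‖} ≤ ENNReal.ofReal (8 * C * (r⁻¹ * r⁻¹)) := by
    intro r hr
    have hr0 : 0 < r := lt_of_lt_of_le (by positivity) hr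
    have hrδ : 2 * r⁻¹ ≤ δ := by
      rw [← div_eq_mul_inv, div_le_iff₀ hr0]
      rw [← div_eq_mul_inv, div_le_iff₀ hδ] at hr
      linarith
    refine iSup₂_le ?_
    rintro _ ⟨n, rfl⟩
    rw [← ofReal_measureReal]
    refine ENNReal.ofReal_le_ofReal ((measureReal_abs_gt_le_integral_charFun hr0).trans ?_)
    have hint : ‖∫ t in (-2 * r⁻¹)..(2 * r⁻¹), 1 - charFun (μ n) t‖
        ≤ C * (2 * r⁻¹) ^ 2 * |2 * r⁻¹ - -2 * r⁻¹| := by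
      refine intervalIntegral.norm_integral_le_of_norm_le_const fun t ht => ?_
      have hr' : 0 < r⁻¹ := by positivity
      rw [Set.uIoc_of_le (by linarith)] at ht
      have habs : |t| ≤ 2 * r⁻¹ := abs_le.mpr ⟨by linarith [ht.1], ht.2⟩
      refine (h n t (habs.trans hrδ)).trans ?_
      rw [← sq_abs t]
      gcongr
    have habs : |2 * r⁻¹ - -2 * r⁻¹| = 4 * r⁻¹ := by
      rw [show 2 * r⁻¹ - -2 * r⁻¹ = 4 * r⁻¹ by ring, abs_of_nonneg (by positivity)]
    rw [habs] at hint
    calc _ ≤ 2⁻¹ * r * (C * (2 * r⁻¹) ^ 2 * (4 * r⁻¹)) := by gcongr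
      _ = 8 * C * (r⁻¹ * r⁻¹) := by field_simp; ring
  refine isTightMeasureSet_of_tendsto_measure_norm_gt ?_
  have hlim : Tendsto (fun r : ℝ => ENNReal.ofReal (8 * C * (r⁻¹ * r⁻¹))) atTop (𝓝 0) := by
    have h1 := (tendsto_inv_atTop_zero (𝕜 := ℝ)).mul (tendsto_inv_atTop_zero (𝕜 := ℝ))
    simpa using ENNReal.tendsto_ofReal (h1.const_mul (8 * C))
  exact tendsto_of_tendsto_of_tendsto_of_le_of_le' tendsto_const_nhds hlim
    (Eventually.of_forall fun _ => zero_le) ((eventually_ge_atTop _).mono hbound)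

end WeakConvergence

section AntiConcentration

/-- A bound on the mass of an interval through the characteristic function, by smoothing with a
Gaussian kernel of width `τ⁻¹`. -/
lemma measureReal_abs_sub_le_le_integral_norm_charFun (μ : Measure ℝ) [IsProbabilityMeasure μ]
    (u : ℝ) {τ : ℝ} (hτ : 0 < τ) :
    μ.real {y | |y - u| ≤ τ⁻¹}
      ≤ Real.exp (1 / 2) * ∫ z, ‖charFun μ (τ * z)‖ ∂(gaussianReal 0 1) := by
  set γ := gaussianReal 0 1
  have hkernel : ∀ y : ℝ, (Real.exp (-(τ * (y - u)) ^ 2 / 2) : ℂ)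
      = ∫ z : ℝ, Complex.exp (-(τ * z * u : ℝ) * Complex.I)
          * Complex.exp ((τ * z * y : ℝ) * Complex.I) ∂γ := by
    intro y
    have := charFun_gaussianReal (μ := 0) (v := 1) (τ * (y - u))
    rw [charFun_apply_real] at this
    calc (Real.exp (-(τ * (y - u)) ^ 2 / 2) : ℂ) = _ := by
          rw [Complex.ofReal_exp]; push_cast; congr 1; ring
      _ = _ := this.symm
      _ = _ := by
        congr 1 with z
        rw [← Complex.exp_add]
        congr 1
        push_cast
        ring
  have hswap : ((∫ y, Real.exp (-(τ * (y - u)) ^ 2 / 2) ∂μ : ℝ) : ℂ)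
      = ∫ z : ℝ, Complex.exp (-(τ * z * u : ℝ) * Complex.I) * charFun μ (τ * z) ∂γ := by
    rw [← integral_complex_ofReal]
    simp_rw [hkernel]
    rw [integral_integral_swap]
    · congr 1 with z
      rw [integral_const_mul, charFun_apply_real]
      congr 3 with y
      push_cast
      rfl
    · refine Integrable.of_bound (C := 1) (Measurable.aestronglyMeasurable ?_)
        (Eventually.of_forall fun q => ?_)
      · unfold Function.uncurry; fun_prop
      · rw [Function.uncurry, norm_mul, Complex.norm_exp_ofReal_mul_I, ← Complex.ofReal_neg,
          Complex.norm_exp_ofReal_mul_I, one_mul]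
  have hle : ∫ y, Real.exp (-(τ * (y - u)) ^ 2 / 2) ∂μ ≤ ∫ z, ‖charFun μ (τ * z)‖ ∂γ := by
    calc _ ≤ ‖((∫ y, Real.exp (-(τ * (y - u)) ^ 2 / 2) ∂μ : ℝ) : ℂ)‖ := by
          rw [Complex.norm_real]; exact le_abs_self _
      _ ≤ _ := by
          rw [hswap]
          refine (norm_integral_le_integral_norm _).trans (le_of_eq ?_)
          congr 1 with z
          rw [norm_mul, ← Complex.ofReal_neg, Complex.norm_exp_ofReal_mul_I, one_mul]
  have hint : Integrable (fun y => Real.exp (-(τ * (y - u)) ^ 2 / 2)) μ := by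
    refine Integrable.of_bound (C := 1) (by fun_prop) (Eventually.of_forall fun y => ?_)
    rw [Real.norm_eq_abs, Real.abs_exp, Real.exp_le_one_iff]
    linarith [sq_nonneg (τ * (y - u))]
  have hmarkov := mul_meas_ge_le_integral_of_nonneg
    (Eventually.of_forall fun y => (Real.exp_pos (-(τ * (y - u)) ^ 2 / 2)).le) hint
    (Real.exp (-(1 / 2)))
  have hsub : {y | |y - u| ≤ τ⁻¹}
      ⊆ {y | Real.exp (-(1 / 2)) ≤ Real.exp (-(τ * (y - u)) ^ 2 / 2)} := by
    intro y hy
    have hy' : |τ * (y - u)| ≤ 1 := by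
      rw [abs_mul, abs_of_pos hτ, ← mul_inv_cancel₀ hτ.ne']
      exact mul_le_mul_of_nonneg_left hy hτ.le
    have := (sq_le_one_iff_abs_le_one _).mpr hy'
    exact Real.exp_le_exp.mpr (by linarith)
  have hm := measureReal_mono (μ := μ) hsub
  have he : Real.exp (1 / 2) * Real.exp (-(1 / 2)) = 1 := by rw [← Real.exp_add]; simp
  calc μ.real {y | |y - u| ≤ τ⁻¹}
      ≤ Real.exp (1 / 2) * (Real.exp (-(1 / 2)) *
          μ.real {y | Real.exp (-(1 / 2)) ≤ Real.exp (-(τ * (y - u)) ^ 2 / 2)}) := by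
        rw [← mul_assoc, he, one_mul]; exact hm
    _ ≤ _ := by gcongr; exact hmarkov.trans hle

/-- Probability measures whose characteristic functions are dominated by one bounded function that
vanishes at infinity give uniformly small mass to short intervals. -/
lemma exists_forall_measureReal_Icc_le {g : ℝ → ℝ} (hg : Continuous g) {C : ℝ}
    (hgC : ∀ t, |g t| ≤ C) (hg0 : Tendsto g (cocompact ℝ) (𝓝 0)) {ε : ℝ} (hε : 0 < ε) :
    ∃ δ > 0, ∀ (μ : Measure ℝ) [IsProbabilityMeasure μ], (∀ t, ‖charFun μ t‖ ≤ g t) →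
      ∀ u, μ.real (Set.Icc u (u + δ)) ≤ ε := by
  have hlim : Tendsto (fun τ : ℝ => ∫ z, g (τ * z) ∂(gaussianReal 0 1)) atTop
      (𝓝 (∫ _, (0 : ℝ) ∂(gaussianReal 0 1))) := by
    refine tendsto_integral_filter_of_dominated_convergence (fun _ => C)
      (Eventually.of_forall fun τ => by fun_prop)
      (Eventually.of_forall fun τ => Eventually.of_forall fun z => hgC _)
      (integrable_const _) ?_
    have := nullSingletonClass_gaussianReal (μ := 0) (v := 1) one_ne_zero
    have hne : ∀ᵐ z ∂(gaussianReal 0 1), z ≠ (0 : ℝ) := by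
      simp [ae_iff]
    filter_upwards [hne] with z hz
    refine hg0.comp ?_
    refine tendsto_norm_atTop_iff_cobounded.mp ?_ |>.trans Metric.cobounded_le_cocompact
    simp_rw [norm_mul]
    exact tendsto_norm_atTop_atTop.atTop_mul_const (norm_pos_iff.mpr hz)
  rw [integral_zero] at hlim
  have hlim' := hlim.const_mul (Real.exp (1 / 2))
  rw [mul_zero] at hlim'
  obtain ⟨τ, hτε, hτ⟩ := ((hlim'.eventually_lt_const hε).and (eventually_gt_atTop 0)).exists
  refine ⟨τ⁻¹, inv_pos.mpr hτ, fun μ _ hμ u => ?_⟩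
  calc μ.real (Set.Icc u (u + τ⁻¹)) ≤ μ.real {y | |y - u| ≤ τ⁻¹} :=
        measureReal_mono fun y ⟨h1, h2⟩ => by
          have := inv_pos.mpr hτ
          exact (abs_le (a := y - u)).mpr ⟨by linarith, by linarith⟩
    _ ≤ Real.exp (1 / 2) * ∫ z, ‖charFun μ (τ * z)‖ ∂(gaussianReal 0 1) :=
        measureReal_abs_sub_le_le_integral_norm_charFun μ u hτ
    _ ≤ Real.exp (1 / 2) * ∫ z, g (τ * z) ∂(gaussianReal 0 1) := by
        gcongr ?_ * ?_
        refine integral_mono_of_nonneg (Eventually.of_forall fun z => norm_nonneg _) ?_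
          (Eventually.of_forall fun z => hμ _)
        exact Integrable.of_bound (C := C) (by fun_prop) (Eventually.of_forall fun z => hgC _)
    _ ≤ ε := hτε.le

end AntiConcentration

section Kolmogorov

lemma measureReal_Iic_le_of_levyProkhorovEDist_lt {μ ν : Measure ℝ} [IsProbabilityMeasure μ]
    [IsProbabilityMeasure ν] {δ : ℝ} (hδ : 0 < δ)
    (h : levyProkhorovEDist μ ν < ENNReal.ofReal δ) (x : ℝ) :
    μ.real (Set.Iic x) ≤ ν.real (Set.Iic x) + ν.real (Set.Icc x (x + δ)) + δ := by
  have h1 := left_measure_le_of_levyProkhorovEDist_lt h (measurableSet_Iic (a := x))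
  rw [ENNReal.toReal_ofReal hδ.le] at h1
  have hsub : Metric.thickening δ (Set.Iic x) ⊆ Set.Iic x ∪ Set.Icc x (x + δ) := by
    intro y hy
    obtain ⟨z, hz, hyz⟩ := Metric.mem_thickening_iff.mp hy
    rcases le_total y x with hyx | hyx
    · exact Or.inl hyx
    · refine Or.inr ⟨hyx, ?_⟩
      have := (abs_lt.mp hyz).2
      have hz' : z ≤ x := hz
      linarith
  have h2 : μ.real (Set.Iic x) ≤ ν.real (Metric.thickening δ (Set.Iic x)) + δ := by
    have := ENNReal.toReal_mono (by finiteness) h1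
    rwa [ENNReal.toReal_add (by finiteness) (by finiteness), ENNReal.toReal_ofReal hδ.le] at this
  linarith [measureReal_mono (μ := ν) hsub, measureReal_union_le (μ := ν) (Set.Iic x) (Set.Icc x (x + δ))]

end Kolmogorov

lemma tendsto_sqrt_sqrt_inv_cocompact :
    Tendsto (fun t : ℝ => √√(1 + 4 * t ^ 2)⁻¹) (cocompact ℝ) (𝓝 0) := by
  have h1 : Tendsto (fun t : ℝ => 1 + 4 * t ^ 2) (cocompact ℝ) atTop := by
    refine tendsto_atTop_add_const_left _ 1 (Tendsto.const_mul_atTop (by norm_num) ?_)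
    have := (tendsto_pow_atTop (α := ℝ) two_ne_zero).comp (tendsto_norm_cocompact_atTop (E := ℝ))
    simpa [Function.comp_def] using this
  have h2 := ((Real.continuous_sqrt.comp Real.continuous_sqrt).tendsto 0).comp
    (tendsto_inv_atTop_zero.comp h1)
  simpa [Function.comp_def] using h2

theorem mainTheorem5 {Ω : Type*} [MeasurableSpace Ω] (P : Measure Ω) [IsProbabilityMeasure P]
    (η : ℕ → Ω → ℝ) (hη_indep : iIndepFun η P) (hη_law : ∀ j, HasLaw (η j) chiSqOne P)
    (p : ℕ → ℕ) (hp : Tendsto p atTop atTop)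
    (a b : (n : ℕ) → Fin (p n) → ℝ)
    (ha_anti : ∀ n, Antitone (a n)) (hb_anti : ∀ n, Antitone (b n))
    (ha_nonneg : ∀ n j, 0 ≤ a n j) (hb_nonneg : ∀ n j, 0 ≤ b n j)
    (ha_sq : ∀ n, 1 ≤ p n → ∑ j, a n j ^ 2 = 1) (hb_sq : ∀ n, 1 ≤ p n → ∑ j, b n j ^ 2 = 1)
    (hab : Tendsto (fun n : ℕ => ⨆ j : Fin (p n), |a n j - b n j|) atTop (𝓝 0)) :
    Tendsto (fun n : ℕ => kolmogorovDist P (centeredMixture η (a n)) (centeredMixture η (b n)))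
      atTop (𝓝 0) := by
  obtain ⟨N, hN⟩ := eventually_atTop.mp (hp.eventually_ge_atTop 1)
  rw [← tendsto_add_atTop_iff_nat N]
  have ha : ∀ n, ∑ j, a (n + N) j ^ 2 = 1 := fun n => ha_sq _ (hN _ (Nat.le_add_left _ _))
  have hb : ∀ n, ∑ j, b (n + N) j ^ 2 = 1 := fun n => hb_sq _ (hN _ (Nat.le_add_left _ _))
  have hmap : ∀ n (w : Fin (p n) → ℝ), IsProbabilityMeasure (P.map (centeredMixture η w)) :=
    fun n w => Measure.isProbabilityMeasure_map (aemeasurable_centeredMixture hη_law w)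
  let μ : ℕ → ProbabilityMeasure ℝ := fun n => ⟨P.map (centeredMixture η (a (n + N))), hmap _ _⟩
  let ν : ℕ → ProbabilityMeasure ℝ := fun n => ⟨P.map (centeredMixture η (b (n + N))), hmap _ _⟩
  have htight : IsTightMeasureSet (Set.range fun n => (μ n : Measure ℝ)) := by
    refine isTightMeasureSet_range_of_norm_one_sub_charFun_le (C := 10) (δ := 1 / 3)
      (by norm_num) fun n t ht => ?_
    refine norm_one_sub_charFun_centeredMixture_le hη_indep hη_law (ha n) ?_
    have := pow_le_pow_left₀ (abs_nonneg t) ht 2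
    rw [sq_abs] at this
    linarith
  have hchar : ∀ t : ℝ, Tendsto
      (fun n => charFun (μ n : Measure ℝ) t - charFun (ν n : Measure ℝ) t) atTop (𝓝 0) := by
    intro t
    have hab' := (tendsto_add_atTop_iff_nat N).mpr hab
    have h8 := hab'.const_mul (8 * |t| ^ 3)
    have h16 := hab'.const_mul (16 * |t| ^ 3)
    rw [mul_zero] at h8 h16
    refine squeeze_zero_norm' ?_ h16
    filter_upwards [h8.eventually_le_const one_pos] with n hn
    exact norm_charFun_centeredMixture_sub_le hη_indep hη_law (ha n) (hb n)
      (fun j => le_ciSup (f := fun j => |a (n + N) j - b (n + N) j|)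
        (Set.finite_range _).bddAbove j) hn
  have hLP := tendsto_levyProkhorovEDist_of_tendsto_charFun_sub htight hchar
  rw [Metric.tendsto_atTop']
  intro ε hε
  obtain ⟨δ, hδ, hconc⟩ := exists_forall_measureReal_Icc_le
    (g := fun t : ℝ => √√(1 + 4 * t ^ 2)⁻¹) (C := 1)
    (by fun_prop (disch := intro t; positivity))
    (fun t => by
      rw [abs_of_nonneg (Real.sqrt_nonneg _)]
      refine Real.sqrt_le_one.mpr (Real.sqrt_le_one.mpr ?_)
      exact inv_le_one_of_one_le₀ (by linarith [sq_nonneg t]))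
    tendsto_sqrt_sqrt_inv_cocompact (show 0 < ε / 3 by positivity)
  set d := min δ (ε / 3)
  have hd : 0 < d := lt_min hδ (by positivity)
  have hconc' : ∀ n (w : Fin (p n) → ℝ), ∑ j, w j ^ 2 = 1 → ∀ x,
      (P.map (centeredMixture η w)).real (Set.Icc x (x + d)) ≤ ε / 3 := fun n w hw x =>
    (measureReal_mono (Set.Icc_subset_Icc_right (by gcongr; exact min_le_left _ _))).trans
      (hconc _ (norm_charFun_centeredMixture_le hη_indep hη_law hw) x)
  obtain ⟨M, hM⟩ := eventually_atTop.mp (hLP.eventually_lt_const (ENNReal.ofReal_pos.mpr hd))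
  refine ⟨M, fun n hn => ?_⟩
  have hcdf : ∀ (w : Fin (p (n + N)) → ℝ) x, P.real {ω | centeredMixture η w ω ≤ x}
      = (P.map (centeredMixture η w)).real (Set.Iic x) := fun w x => by
    rw [map_measureReal_apply_of_aemeasurable (aemeasurable_centeredMixture hη_law w)
      measurableSet_Iic]
    rfl
  have hle : kolmogorovDist P (centeredMixture η (a (n + N))) (centeredMixture η (b (n + N)))
      ≤ 2 * ε / 3 := by
    refine ciSup_le fun x => ?_
    rw [hcdf, hcdf]
    have hlt := hM n hn.le
    have h1 := measureReal_Iic_le_of_levyProkhorovEDist_lt hd hlt x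
    rw [levyProkhorovEDist_comm] at hlt
    have h2 := measureReal_Iic_le_of_levyProkhorovEDist_lt hd hlt x
    have h3 := hconc' _ _ (ha n) x
    have h4 := hconc' _ _ (hb n) x
    have h5 : d ≤ ε / 3 := min_le_right _ _
    simp only [μ, ν, ProbabilityMeasure.coe_mk] at h1 h2
    rw [abs_le]
    constructor <;> linarith
  have h0 : 0 ≤ kolmogorovDist P (centeredMixture η (a (n + N))) (centeredMixture η (b (n + N))) :=
    Real.iSup_nonneg fun _ => abs_nonneg _
  rw [Real.dist_eq, sub_zero, abs_of_nonneg h0]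
  linarith
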